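/- Let $K$ be an algebraically closed field (of arbitrary characteristic), let $G=\mathrm{SL}_2(K)$, and let $E=K^2$ be the natural $G$-module of column vectors, with natural basis $x_1,x_2$. For $r\ge 0$ let $\nabla(r)=S^rE$ be the $r$-th symmetric power of $E$ (the degree $r$ component of the symmetric algebra $S(E)$) and let $\Delta(r)=\nabla(r)^*$ be its dual module. For $r\ge 0$ let $\alpha:\nabla(r)\otimes E\to\nabla(r+1)$ be the $G$-module homomorphism given by multiplication in $S(E)$. For $s>0$ let $$\beta:\Delta(s)\to E\otimes\Delta(s-1),\qquad \beta(\varphi)=x_1\otimes\varphi(x_2\,\cdot)-x_2\otimes\varphi(x_1\,\cdot),$$ be the $G$-module homomorphism dual to the multiplication map $E\otimes S^{s-1}E\to S^sE$, where $E$ is identified with $E^*$ by $x\mapsto\det(x,\cdot)$. Suppose that $r\ge s>0$. Then $\beta$ is injective, and, writing $$\theta=(\alpha\otimes\mathrm{id})\circ(\mathrm{id}\otimes\beta):\nabla(r)\otimes\Delta(s)\to\nabla(r+1)\otimes\Delta(s-1),$$ there is a homomorphism of $G$-modules $\iota:\nabla(r-s)\to\nabla(r)\otimes\Delta(s)$ such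 that $$0\to\nabla(r-s)\xrightarrow{\ \iota\ }\nabla(r)\otimes\Delta(s)\xrightarrow{\ \theta\ }\nabla(r+1)\otimes\Delta(s-1)\to 0$$ is a short exact sequence of $G$-modules. -/

import Mathlib

open scoped TensorProduct

namespace SLTwo

noncomputable section

/-- The natural module `E` of column vectors of length two: the underlying space. -/
abbrev E (K : Type*) [Field K] : Type _ := Fin 2 → K

/-- The natural representation of `SL₂(K)` on column vectors. -/
def natural (K : Type*) [Field K] :
    Representation K (Matrix.SpecialLinearGroup (Fin 2) K) (E K) where
  toFun g := Matrix.mulVecLin (g : Matrix (Fin 2) (Fin 2) K)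
  map_one' := by simp; rfl
  map_mul' g h := by simp [Matrix.mulVecLin_mul]; rfl

/-- The action of `SL₂(K)` on the symmetric algebra `S(E)` by algebra endomorphisms, extending the
natural action on `E`. -/
def symAlg (K : Type*) [Field K] :
    Representation K (Matrix.SpecialLinearGroup (Fin 2) K) (SymmetricAlgebra K (E K)) where
  toFun g := (SymmetricAlgebra.lift (SymmetricAlgebra.ι K (E K) ∘ₗ natural K g)).toLinearMap
  map_one' := by
    have : SymmetricAlgebra.lift (SymmetricAlgebra.ι K (E K) ∘ₗ natural K 1)
        = AlgHom.id K (SymmetricAlgebra K (E K)) := by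
      apply SymmetricAlgebra.algHom_ext
      ext x
      simp
    rw [this]; rfl
  map_mul' g h := by
    have : SymmetricAlgebra.lift (SymmetricAlgebra.ι K (E K) ∘ₗ natural K (g * h))
        = (SymmetricAlgebra.lift (SymmetricAlgebra.ι K (E K) ∘ₗ natural K g)).comp
          (SymmetricAlgebra.lift (SymmetricAlgebra.ι K (E K) ∘ₗ natural K h)) := by
      apply SymmetricAlgebra.algHom_ext
      apply LinearMap.ext
      intro x
      simp [SymmetricAlgebra.lift_ι_apply]
    rw [this]; rfl

/-- The `r`-th symmetric power `S^r E`: the degree `r` component of the symmetric algebra, that is,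
the span of the products of `r` elements of `E`. -/
abbrev SymPow (K : Type*) [Field K] (r : ℕ) : Submodule K (SymmetricAlgebra K (E K)) :=
  (LinearMap.range (SymmetricAlgebra.ι K (E K))) ^ r

theorem symPow_le_comap (K : Type*) [Field K] (r : ℕ)
    (g : Matrix.SpecialLinearGroup (Fin 2) K) :
    SymPow K r ≤ (SymPow K r).comap (symAlg K g) := by
  rw [← Submodule.map_le_iff_le_comap]
  change Submodule.map
    (SymmetricAlgebra.lift (SymmetricAlgebra.ι K (E K) ∘ₗ natural K g)).toLinearMap _ ≤ _
  rw [SymPow, Submodule.map_pow]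
  apply pow_le_pow_left'
  rintro _ ⟨_, ⟨x, rfl⟩, rfl⟩
  exact ⟨natural K g x, by simp [SymmetricAlgebra.lift_ι_apply]⟩

/-- The module `∇(r) = S^r E`. -/
def nabla (K : Type*) [Field K] (r : ℕ) :
    Representation K (Matrix.SpecialLinearGroup (Fin 2) K) (SymPow K r) :=
  (symAlg K).subrepresentation (SymPow K r) (symPow_le_comap K r)

/-- The Weyl module `Δ(r)`, the dual module of `∇(r)`. -/
def weyl (K : Type*) [Field K] (r : ℕ) :
    Representation K (Matrix.SpecialLinearGroup (Fin 2) K) (Module.Dual K (SymPow K r)) :=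
  (nabla K r).dual

/-- Multiplication in the symmetric algebra, as a bilinear map `S^a E × E → S^(a+1) E`. The target
degree is a variable `b = a + 1`. -/
def symMul (K : Type*) [Field K] {a b : ℕ} (h : b = a + 1) :
    SymPow K a →ₗ[K] E K →ₗ[K] SymPow K b :=
  LinearMap.mk₂ K
    (fun f y => ⟨(f : SymmetricAlgebra K (E K)) * SymmetricAlgebra.ι K (E K) y, by
      subst h
      rw [SymPow, pow_succ]
      exact Submodule.mul_mem_mul f.2 ⟨y, rfl⟩⟩)
    (fun f f' y => by ext; simp [add_mul])
    (fun c f y => by ext; simp)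
    (fun f y y' => by ext; simp [mul_add])
    (fun c f y => by ext; simp)

theorem coe_symMul (K : Type*) [Field K] {a b : ℕ} (h : b = a + 1) (f : SymPow K a) (y : E K) :
    (symMul K h f y : SymmetricAlgebra K (E K)) = f * SymmetricAlgebra.ι K (E K) y := rfl

theorem symMul_equivariant (K : Type*) [Field K] {a b : ℕ} (h : b = a + 1)
    (g : Matrix.SpecialLinearGroup (Fin 2) K) (f : SymPow K a) (y : E K) :
    symMul K h (nabla K a g f) (natural K g y) = nabla K b g (symMul K h f y) := by
  ext
  change (SymmetricAlgebra.lift (SymmetricAlgebra.ι K (E K) ∘ₗ natural K g)) f * _ =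
    (SymmetricAlgebra.lift (SymmetricAlgebra.ι K (E K) ∘ₗ natural K g))
      (f * SymmetricAlgebra.ι K (E K) y)
  simp [SymmetricAlgebra.lift_ι_apply]

/-- The homomorphism `α : S^r E ⊗ E → S^(r+1) E` given by multiplication in the symmetric
algebra. -/
def mulHom (K : Type*) [Field K] (r : ℕ) :
    ((nabla K r).tprod (natural K)).IntertwiningMap (nabla K (r + 1)) where
  toLinearMap := TensorProduct.lift (symMul K rfl)
  isIntertwining' g := by
    apply TensorProduct.ext'
    intro f y
    simp [symMul_equivariant]

/-- The linear map underlying the embedding `β : Δ(s) → E ⊗ Δ(s-1)`, for `s > 0`: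
`β(φ) = x₁ ⊗ φ(x₂ ·) - x₂ ⊗ φ(x₁ ·)`, where `x₁, x₂` is the natural basis of `E`. -/
def weylLin (K : Type*) [Field K] {s : ℕ} (hs : 0 < s) :
    Module.Dual K (SymPow K s) →ₗ[K] E K ⊗[K] Module.Dual K (SymPow K (s - 1)) :=
  TensorProduct.mk K (E K) (Module.Dual K (SymPow K (s - 1))) (Pi.single 0 1) ∘ₗ
      Module.Dual.transpose ((symMul K (Nat.sub_add_cancel hs).symm).flip (Pi.single 1 1))
    - TensorProduct.mk K (E K) (Module.Dual K (SymPow K (s - 1))) (Pi.single 1 1) ∘ₗ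
      Module.Dual.transpose ((symMul K (Nat.sub_add_cancel hs).symm).flip (Pi.single 0 1))

/-- The isomorphism of `SL₂(K)`-modules `E → E*`, as a linear map, sending `x` to the functional
`y ↦ det (x, y)`. -/
def areaForm (K : Type*) [Field K] : E K →ₗ[K] Module.Dual K (E K) :=
  LinearMap.mk₂ K (fun x y => x 0 * y 1 - x 1 * y 0)
    (fun _ _ _ => by simp; ring) (fun _ _ _ => by simp; ring)
    (fun _ _ _ => by simp; ring) (fun _ _ _ => by simp; ring)

/-- `weylLin` is the dual of the multiplication map `E ⊗ S^(s-1) E → S^s E`, once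
`(E ⊗ S^(s-1) E)*` is identified with `E* ⊗ Δ(s-1)` and then with `E ⊗ Δ(s-1)`. -/
theorem weylLin_spec (K : Type*) [Field K] {s : ℕ} (hs : 0 < s)
    (φ : Module.Dual K (SymPow K s)) (y : E K) (f : SymPow K (s - 1)) :
    dualTensorHom K (E K) (Module.Dual K (SymPow K (s - 1)))
      ((areaForm K).rTensor _ (weylLin K hs φ)) y f
      = φ (symMul K (Nat.sub_add_cancel hs).symm f y) := by
  have hy : y = y 0 • Pi.single 0 1 + y 1 • Pi.single 1 1 := by
    ext i; fin_cases i <;> simp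
  conv_rhs => rw [hy]
  simp [weylLin, areaForm, Module.Dual.transpose_apply]
  ring

theorem areaForm_bijective (K : Type*) [Field K] : Function.Bijective (areaForm K) := by
  have hinj : Function.Injective (areaForm K) := by
    rw [injective_iff_map_eq_zero]
    intro x hx
    have h0 := LinearMap.congr_fun hx (Pi.single 0 1)
    have h1 := LinearMap.congr_fun hx (Pi.single 1 1)
    simp [areaForm] at h0 h1
    ext i
    fin_cases i <;> simp [h0, h1]
  exact ⟨hinj, (LinearMap.injective_iff_surjective_of_finrank_eq_finrank
    Subspace.dual_finrank_eq.symm).1 hinj⟩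

theorem areaForm_equivariant (K : Type*) [Field K] (g : Matrix.SpecialLinearGroup (Fin 2) K)
    (x : E K) : areaForm K (natural K g x) = (natural K).dual g (areaForm K x) := by
  have hd := g.det_coe
  rw [Matrix.det_fin_two] at hd
  ext i
  fin_cases i <;>
    simp [areaForm, natural, Module.Dual.transpose_apply,
      Matrix.SpecialLinearGroup.coe_inv, Matrix.adjugate_fin_two] <;> ring

theorem weylLin_equivariant (K : Type*) [Field K] {s : ℕ} (hs : 0 < s)
    (g : Matrix.SpecialLinearGroup (Fin 2) K) (φ : Module.Dual K (SymPow K s)) :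
    weylLin K hs (weyl K s g φ)
      = ((natural K).tprod (weyl K (s - 1))) g (weylLin K hs φ) := by
  set m := symMul K (Nat.sub_add_cancel hs).symm with hm
  have key : ∀ y : E K, Module.Dual.transpose (m.flip y) (weyl K s g φ) =
      weyl K (s - 1) g (Module.Dual.transpose (m.flip (natural K g⁻¹ y)) φ) := by
    intro y
    ext f
    simp [weyl, Module.Dual.transpose_apply, hm, ← symMul_equivariant]
  have h0 : natural K g⁻¹ (Pi.single 0 1) = g 1 1 • Pi.single 0 1 - g 1 0 • Pi.single 1 1 := by
    ext i
    fin_cases i <;> simp [natural, Matrix.SpecialLinearGroup.coe_inv, Matrix.adjugate_fin_two]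
  have h1 : natural K g⁻¹ (Pi.single 1 1) = - g 0 1 • Pi.single 0 1 + g 0 0 • Pi.single 1 1 := by
    ext i
    fin_cases i <;> simp [natural, Matrix.SpecialLinearGroup.coe_inv, Matrix.adjugate_fin_two]
  have e0 : natural K g (Pi.single 0 1) = g 0 0 • Pi.single 0 1 + g 1 0 • Pi.single 1 1 := by
    ext i
    fin_cases i <;> simp [natural]
  have e1 : natural K g (Pi.single 1 1) = g 0 1 • Pi.single 0 1 + g 1 1 • Pi.single 1 1 := by
    ext i
    fin_cases i <;> simp [natural]
  simp only [weylLin, LinearMap.sub_apply, LinearMap.comp_apply, TensorProduct.mk_apply, ← hm,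
    key, h0, h1, map_sub, map_add, map_smul, LinearMap.add_apply, LinearMap.smul_apply,
    Representation.tprod_apply, TensorProduct.map_tmul, e0, e1, TensorProduct.add_tmul,
    TensorProduct.smul_tmul,
    TensorProduct.tmul_smul]
  module

/-- The homomorphism `β : Δ(s) → E ⊗ Δ(s-1)` of `SL₂(K)`-modules, for `s > 0`, dual to the
multiplication `E ⊗ S^(s-1) E → S^s E`. -/
def weylHom (K : Type*) [Field K] {s : ℕ} (hs : 0 < s) :
    (weyl K s).IntertwiningMap ((natural K).tprod (weyl K (s - 1))) where
  toLinearMap := weylLin K hs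
  isIntertwining' g := LinearMap.ext (weylLin_equivariant K hs g)

/-- The homomorphism `θ = (α ⊗ id) ∘ (id ⊗ β) : ∇(r) ⊗ Δ(s) → ∇(r+1) ⊗ Δ(s-1)`, for `s > 0`. -/
def theta (K : Type*) [Field K] (r : ℕ) {s : ℕ} (hs : 0 < s) :
    ((nabla K r).tprod (weyl K s)).IntertwiningMap
      ((nabla K (r + 1)).tprod (weyl K (s - 1))) :=
  ((mulHom K r).rTensor (weyl K (s - 1))).comp
    ((Representation.TensorProduct.assoc (nabla K r) (natural K)
      (weyl K (s - 1))).symm.toIntertwiningMap.comp ((weylHom K hs).lTensor (nabla K r)))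

end

end SLTwo

/-!
A tensor in `∇(r) ⊗ Δ(s)` is the same thing as a linear map `T : S^s E → S^r E` (`homEquiv`), and in
these terms `θ` sends `T` to the map `h ↦ x₁ T(x₂ h) - x₂ T(x₁ h)` (`homEquiv_theta`). So `T` lies in
the kernel exactly when it satisfies `x₁ T(x₂ h) = x₂ T(x₁ h)` for all `h` of degree `s - 1`.

Multiplication by a form `q` of degree `r - s` satisfies this, and `q ↦ (f ↦ q f)` is a homomorphism
of `SL₂(K)`-modules because the group acts on `S(E)` by algebra endomorphisms; this is the map `ι`
(`kernelHom`). Conversely, iterating the relation gives `f T(x₂ˢ) = x₂ˢ T(f)` for all `f` of degree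
`s` (`mul_map_mul_pow_comm`). With `f = x₁ˢ`, coprimality of `x₁` and `x₂` yields `T(x₂ˢ) = x₂ˢ q`,
and cancelling `x₂ˢ` shows that `T` is multiplication by `q` (`exists_mulLin_eq`). Divisibility and
homogeneity in `S(E)` are read off in the polynomial ring in two variables.

Thus the kernel of `θ` has dimension `r - s + 1`. As `dim S^n E = n + 1` (`finrank_symPow`), this is
the difference of the dimensions of source and target, so `θ` is surjective. Injectivity of `β` holds
because it is dual to multiplication `E ⊗ S^(s-1) E → S^s E`, which is surjective for `s > 0`.
-/

namespace SLTwo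

noncomputable section

/-! ### The grading of the symmetric algebra of a plane -/

/-- The isomorphism of the symmetric algebra `S(E)` with the polynomial ring in two variables that
sends the natural basis `x₁, x₂` of `E` to the variables. -/
def symEquiv (K : Type*) [Field K] :
    SymmetricAlgebra K (E K) ≃ₐ[K] MvPolynomial (Fin 2) K :=
  SymmetricAlgebra.equivMvPolynomial (Pi.basisFun K (Fin 2))

theorem symEquiv_ι (K : Type*) [Field K] (i : Fin 2) :
    symEquiv K (SymmetricAlgebra.ι K (E K) (Pi.single i 1)) = MvPolynomial.X i := by
  rw [← Pi.basisFun_apply, symEquiv, SymmetricAlgebra.equivMvPolynomial_ι_apply]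

theorem map_symEquiv_symPow (K : Type*) [Field K] (n : ℕ) :
    (SymPow K n).map (symEquiv K).toAlgHom.toLinearMap =
      MvPolynomial.homogeneousSubmodule (Fin 2) K n := by
  rw [SymPow, Submodule.map_pow, ← MvPolynomial.homogeneousSubmodule_one_pow,
    MvPolynomial.homogeneousSubmodule_one_eq_span_X]
  congr 1
  rw [← Submodule.map_top, ← (Pi.basisFun K (Fin 2)).span_eq, Submodule.map_span,
    Submodule.map_span, ← Set.range_comp, ← Set.range_comp]
  congr 2
  ext1 i
  simpa using symEquiv_ι K i

theorem mem_symPow_iff (K : Type*) [Field K] (n : ℕ) (f : SymmetricAlgebra K (E K)) :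
    f ∈ SymPow K n ↔ (symEquiv K f).IsHomogeneous n := by
  rw [← MvPolynomial.mem_homogeneousSubmodule, ← map_symEquiv_symPow]
  exact ((symEquiv K).injective.mem_set_image (s := (SymPow K n : Set _))).symm

/-- The equivalence of `S^n E` with the space of binary forms of degree `n`. -/
def symPowEquiv (K : Type*) [Field K] (n : ℕ) :
    SymPow K n ≃ₗ[K] MvPolynomial.homogeneousSubmodule (Fin 2) K n :=
  (Submodule.equivMapOfInjective (symEquiv K).toAlgHom.toLinearMap
    (symEquiv K).injective (SymPow K n)).trans (LinearEquiv.ofEq _ _ (map_symEquiv_symPow K n))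

instance (K : Type*) [Field K] (n : ℕ) : Module.Finite K (SymPow K n) :=
  have : Module.Finite K (MvPolynomial.homogeneousSubmodule (Fin 2) K n) :=
    Module.Finite.iff_fg.2 (MvPolynomial.homogeneousSubmodule_fg (Fin 2) K n)
  Module.Finite.equiv (symPowEquiv K n).symm

theorem finrank_symPow (K : Type*) [Field K] (n : ℕ) :
    Module.finrank K (SymPow K n) = n + 1 := by
  rw [(symPowEquiv K n).finrank_eq, MvPolynomial.homogeneousSubmodule_eq_finsupp_supported,
    (AddMonoidAlgebra.supportedEquivFinsupp _).finrank_eq]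
  have h : {d : Fin 2 →₀ ℕ | d.degree = n} =
      (Finset.univ.finsuppAntidiag n : Finset (Fin 2 →₀ ℕ)) := by
    ext d
    simp [Finsupp.degree_eq_sum]
  rw [h, Module.finrank_finsupp_self, ← Nat.card_eq_fintype_card, Nat.card_coe_set_eq,
    Set.ncard_coe_finset, Finset.card_finsuppAntidiag_nat_eq_choose]
  simp [show 2 + n - 1 = n + 1 by omega]

theorem mul_mem_symPow {K : Type*} [Field K] {a b c : ℕ} (h : a + b = c)
    {f g : SymmetricAlgebra K (E K)} (hf : f ∈ SymPow K a) (hg : g ∈ SymPow K b) :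
    f * g ∈ SymPow K c := by
  rw [← h, SymPow, pow_add]
  exact Submodule.mul_mem_mul hf hg

theorem ι_pow_mem_symPow {K : Type*} [Field K] (v : E K) (n : ℕ) :
    SymmetricAlgebra.ι K (E K) v ^ n ∈ SymPow K n :=
  Submodule.pow_mem_pow _ (LinearMap.mem_range_self _ v) n

/-- A cofactor of a power of a basis vector in a homogeneous element is homogeneous. -/
theorem mem_symPow_of_pow_mul_mem {K : Type*} [Field K] (i : Fin 2) {s m : ℕ}
    {q : SymmetricAlgebra K (E K)}
    (h : SymmetricAlgebra.ι K (E K) (Pi.single i 1) ^ s * q ∈ SymPow K (s + m)) :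
    q ∈ SymPow K m := by
  rw [mem_symPow_iff, map_mul, map_pow, symEquiv_ι, MvPolynomial.X_pow_eq_monomial] at h
  rw [mem_symPow_iff]
  intro d hd
  have := h (d := Finsupp.single i s + d) (by simpa [MvPolynomial.coeff_monomial_mul] using hd)
  simpa [Finsupp.weight_single] using this

theorem prime_ι_single (K : Type*) [Field K] (i : Fin 2) :
    Prime (SymmetricAlgebra.ι K (E K) (Pi.single i 1)) := by
  rw [← MulEquiv.prime_iff (symEquiv K), symEquiv_ι]
  exact MvPolynomial.X_prime

theorem not_ι_single_dvd (K : Type*) [Field K] {i j : Fin 2} (h : i ≠ j) :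
    ¬ SymmetricAlgebra.ι K (E K) (Pi.single i 1) ∣ SymmetricAlgebra.ι K (E K) (Pi.single j 1) := by
  rw [← map_dvd_iff (symEquiv K), symEquiv_ι, symEquiv_ι, MvPolynomial.X_dvd_X]
  simpa using h

/-! ### Tensors as linear maps between symmetric powers -/

/-- The isomorphism `∇(r) ⊗ Δ(s) ≅ Hom(S^s E, S^r E)` of `SL₂(K)`-modules, sending `f ⊗ φ` to
`h ↦ φ(h) f`. -/
def homEquiv (K : Type*) [Field K] (r s : ℕ) :
    ((nabla K r).tprod (weyl K s)).Equiv ((nabla K s).linHom (nabla K r)) :=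
  (Representation.TensorProduct.comm (nabla K r) (weyl K s)).trans
    (Representation.Equiv.dualTensorHom (nabla K s) (nabla K r))

theorem homEquiv_tmul (K : Type*) [Field K] (r s : ℕ) (f : SymPow K r)
    (φ : Module.Dual K (SymPow K s)) (h : SymPow K s) :
    homEquiv K r s (f ⊗ₜ φ) h = φ h • f := rfl

theorem theta_tmul (K : Type*) [Field K] (r : ℕ) {s : ℕ} (hs : 0 < s) (f : SymPow K r)
    (φ : Module.Dual K (SymPow K s)) :
    theta K r hs (f ⊗ₜ φ) =
      symMul K rfl f (Pi.single 0 1) ⊗ₜ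
        Module.Dual.transpose ((symMul K (Nat.sub_add_cancel hs).symm).flip (Pi.single 1 1)) φ -
      symMul K rfl f (Pi.single 1 1) ⊗ₜ
        Module.Dual.transpose
          ((symMul K (Nat.sub_add_cancel hs).symm).flip (Pi.single 0 1)) φ := by
  let L : E K ⊗[K] Module.Dual K (SymPow K (s - 1)) →ₗ[K]
      SymPow K (r + 1) ⊗[K] Module.Dual K (SymPow K (s - 1)) :=
    (TensorProduct.lift (symMul K rfl)).rTensor (Module.Dual K (SymPow K (s - 1))) ∘ₗ
      (TensorProduct.assoc K _ _ _).symm.toLinearMap ∘ₗ TensorProduct.mk K _ _ f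
  change L (weylLin K hs φ) = _
  rw [weylLin, LinearMap.sub_apply, map_sub]
  rfl

/-- In terms of linear maps, `θ` sends `T` to `h ↦ x₁ T(x₂ h) - x₂ T(x₁ h)`. -/
theorem homEquiv_theta (K : Type*) [Field K] (r : ℕ) {s : ℕ} (hs : 0 < s)
    (t : SymPow K r ⊗[K] Module.Dual K (SymPow K s)) (h : SymPow K (s - 1)) :
    homEquiv K (r + 1) (s - 1) (theta K r hs t) h =
      symMul K rfl (homEquiv K r s t (symMul K (Nat.sub_add_cancel hs).symm h (Pi.single 1 1)))
        (Pi.single 0 1) -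
      symMul K rfl (homEquiv K r s t (symMul K (Nat.sub_add_cancel hs).symm h (Pi.single 0 1)))
        (Pi.single 1 1) := by
  have hadd (a b : ℕ) (u v : SymPow K a ⊗[K] Module.Dual K (SymPow K b)) :
      homEquiv K a b (u + v) = homEquiv K a b u + homEquiv K a b v :=
    (homEquiv K a b).toLinearEquiv.map_add u v
  have hzero (a b : ℕ) : homEquiv K a b 0 = 0 := (homEquiv K a b).toLinearEquiv.map_zero
  have hθ : theta K r hs 0 = 0 := (theta K r hs).toLinearMap.map_zero
  have hθadd (u v : SymPow K r ⊗[K] Module.Dual K (SymPow K s)) :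
      theta K r hs (u + v) = theta K r hs u + theta K r hs v :=
    (theta K r hs).toLinearMap.map_add u v
  induction t with
  | zero => rw [hθ, hzero, hzero]; simp
  | add t t' ht ht' =>
    rw [hθadd, hadd, hadd]
    simp only [map_add, LinearMap.add_apply, ht, ht']
    abel
  | tmul f φ =>
    have hsub (u v : SymPow K (r + 1) ⊗[K] Module.Dual K (SymPow K (s - 1))) :
        homEquiv K (r + 1) (s - 1) (u - v) =
          homEquiv K (r + 1) (s - 1) u - homEquiv K (r + 1) (s - 1) v :=
      map_sub (homEquiv K (r + 1) (s - 1)).toLinearEquiv u v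
    rw [theta_tmul, hsub]
    simp [homEquiv_tmul, Module.Dual.transpose_apply]

/-! ### The kernel -/

/-- Multiplication by a form of degree `r - s`, as a linear map `S^s E → S^r E`. -/
def mulLin (K : Type*) [Field K] {r s : ℕ} (hrs : s ≤ r) :
    SymPow K (r - s) →ₗ[K] SymPow K s →ₗ[K] SymPow K r :=
  LinearMap.mk₂ K
    (fun q f => ⟨q * f, mul_mem_symPow (Nat.sub_add_cancel hrs) q.2 f.2⟩)
    (fun q q' f => by ext; simp [add_mul])
    (fun c q f => by ext; simp)
    (fun q f f' => by ext; simp [mul_add])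
    (fun c q f => by ext; simp)

theorem coe_mulLin (K : Type*) [Field K] {r s : ℕ} (hrs : s ≤ r) (q : SymPow K (r - s))
    (f : SymPow K s) :
    (mulLin K hrs q f : SymmetricAlgebra K (E K)) = q * f := rfl

theorem coe_nabla (K : Type*) [Field K] (n : ℕ) (g : Matrix.SpecialLinearGroup (Fin 2) K)
    (f : SymPow K n) :
    (nabla K n g f : SymmetricAlgebra K (E K)) =
      SymmetricAlgebra.lift (SymmetricAlgebra.ι K (E K) ∘ₗ natural K g) f := rfl

/-- The homomorphism `∇(r-s) → Hom(S^s E, S^r E)` of `SL₂(K)`-modules sending a form to the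
multiplication by it. -/
def mulIntertwining (K : Type*) [Field K] {r s : ℕ} (hrs : s ≤ r) :
    (nabla K (r - s)).IntertwiningMap ((nabla K s).linHom (nabla K r)) where
  toLinearMap := mulLin K hrs
  isIntertwining' g := by
    refine LinearMap.ext fun q => LinearMap.ext fun f => ?_
    obtain ⟨f, rfl⟩ : ∃ f', nabla K s g f' = f := ⟨nabla K s g⁻¹ f, by simp⟩
    ext
    simp only [LinearMap.comp_apply, Representation.linHom_apply,
      Representation.inv_self_apply, coe_mulLin, coe_nabla, map_mul]

theorem mulIntertwining_apply (K : Type*) [Field K] {r s : ℕ} (hrs : s ≤ r)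
    (q : SymPow K (r - s)) : mulIntertwining K hrs q = mulLin K hrs q := rfl

/-- The relation `x₁ T(x₂ h) = x₂ T(x₁ h)` propagates from `E` to all degrees: `f T(g x₂ⁿ)` equals
`x₂ⁿ T(g f)`. The map `T` is extended to the whole symmetric algebra, so that no bookkeeping of
degrees is needed in its argument. -/
theorem mul_map_mul_pow_comm (K : Type*) [Field K] {s : ℕ}
    (T : SymmetricAlgebra K (E K) →ₗ[K] SymmetricAlgebra K (E K))
    (hT : ∀ h ∈ SymPow K (s - 1),
      SymmetricAlgebra.ι K (E K) (Pi.single 0 1) *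
          T (h * SymmetricAlgebra.ι K (E K) (Pi.single 1 1)) =
        SymmetricAlgebra.ι K (E K) (Pi.single 1 1) *
          T (h * SymmetricAlgebra.ι K (E K) (Pi.single 0 1)))
    (n m : ℕ) (hnm : n + m = s) (f g : SymmetricAlgebra K (E K)) (hf : f ∈ SymPow K n)
    (hg : g ∈ SymPow K m) :
    f * T (g * SymmetricAlgebra.ι K (E K) (Pi.single 1 1) ^ n) =
      SymmetricAlgebra.ι K (E K) (Pi.single 1 1) ^ n * T (g * f) := by
  set x := SymmetricAlgebra.ι K (E K) (Pi.single 0 1)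
  set y := SymmetricAlgebra.ι K (E K) (Pi.single 1 1)
  have hE (v : E K) (h) (hh : h ∈ SymPow K (s - 1)) :
      SymmetricAlgebra.ι K (E K) v * T (h * y) = y * T (h * SymmetricAlgebra.ι K (E K) v) := by
    have hv : SymmetricAlgebra.ι K (E K) v = v 0 • x + v 1 • y := by
      rw [← map_smul, ← map_smul, ← map_add]
      congr 1
      ext i; fin_cases i <;> simp
    simp only [hv, add_mul, mul_add, smul_mul_assoc, mul_smul_comm, map_add, map_smul, hT h hh]
  induction n generalizing m f g with
  | zero =>
    obtain ⟨c, rfl⟩ : ∃ c, algebraMap K _ c = f := by simpa [SymPow, Submodule.mem_one] using hf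
    simp [← Algebra.commutes c g, ← Algebra.smul_def]
  | succ n ih =>
    rw [SymPow, pow_succ] at hf
    induction hf using Submodule.mul_induction_on' with
    | add f _ f' _ hf hf' => simp only [add_mul, mul_add, map_add, hf, hf']
    | mem_mul_mem f hf z hz =>
      obtain ⟨v, rfl⟩ := hz
      have h1 := hE v (g * y ^ n)
        (mul_mem_symPow (by omega) hg (ι_pow_mem_symPow _ n))
      have h2 := ih (m + 1) (by omega) f (g * SymmetricAlgebra.ι K (E K) v) hf
        (mul_mem_symPow rfl hg (by simp [SymPow]))
      calc f * SymmetricAlgebra.ι K (E K) v * T (g * y ^ (n + 1))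
          = f * (SymmetricAlgebra.ι K (E K) v * T (g * y ^ n * y)) := by
            rw [pow_succ]; simp only [mul_assoc]
        _ = y * (f * T (g * SymmetricAlgebra.ι K (E K) v * y ^ n)) := by
            rw [h1, mul_right_comm g, mul_left_comm]
        _ = y ^ (n + 1) * T (g * (f * SymmetricAlgebra.ι K (E K) v)) := by
            rw [h2, pow_succ', mul_assoc y, mul_assoc g, mul_comm f]

/-- Since `x₁ˢ T(x₂ˢ) = x₂ˢ T(x₁ˢ)` and `x₁, x₂` are coprime, `T(x₂ˢ) = x₂ˢ q` for some `q`, and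
then `T` is the multiplication by `q`. -/
theorem exists_mulLin_eq (K : Type*) [Field K] {r s : ℕ} (hs : 0 < s) (hrs : s ≤ r)
    (T : SymPow K s →ₗ[K] SymPow K r)
    (hT : ∀ h : SymPow K (s - 1),
      symMul K rfl (T (symMul K (Nat.sub_add_cancel hs).symm h (Pi.single 1 1))) (Pi.single 0 1) =
      symMul K (b := r + 1) rfl (T (symMul K (Nat.sub_add_cancel hs).symm h (Pi.single 0 1)))
        (Pi.single 1 1)) :
    ∃ q, mulLin K hrs q = T := by
  obtain ⟨T', hT'⟩ := LinearMap.exists_extend ((SymPow K r).subtype ∘ₗ T)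
  replace hT' (f) (hf : f ∈ SymPow K s) : T' f = T ⟨f, hf⟩ := LinearMap.congr_fun hT' ⟨f, hf⟩
  have key (f) (hf : f ∈ SymPow K s) := mul_map_mul_pow_comm K (s := s) T' (fun h hh => by
    have hv (v : E K) : T' (h * SymmetricAlgebra.ι K (E K) v) =
        T (symMul K (Nat.sub_add_cancel hs).symm ⟨h, hh⟩ v) :=
      hT' _ (symMul K (Nat.sub_add_cancel hs).symm ⟨h, hh⟩ v).2
    rw [hv, hv, mul_comm, mul_comm (SymmetricAlgebra.ι K (E K) (Pi.single 1 1))]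
    exact congrArg Subtype.val (hT ⟨h, hh⟩)) s 0 rfl f 1 hf (by simp [SymPow])
  simp only [one_mul] at key
  have hx := ι_pow_mem_symPow (Pi.single 0 1 : E K) s
  have hy := ι_pow_mem_symPow (Pi.single 1 1 : E K) s
  set x := SymmetricAlgebra.ι K (E K) (Pi.single 0 1)
  set y := SymmetricAlgebra.ι K (E K) (Pi.single 1 1)
  have hp : Prime y := prime_ι_single K 1
  obtain ⟨q, hq⟩ : y ^ s ∣ T' (y ^ s) :=
    hp.pow_dvd_of_dvd_mul_left s (a := x ^ s)
      (fun h => not_ι_single_dvd K (by decide) (hp.dvd_of_dvd_pow h)) ⟨_, key _ hx⟩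
  have hqm : q ∈ SymPow K (r - s) := by
    apply mem_symPow_of_pow_mul_mem 1 (s := s)
    rw [Nat.add_sub_cancel' hrs, ← hq, hT' _ hy]
    exact (T _).2
  refine ⟨⟨q, hqm⟩, LinearMap.ext fun f => Subtype.ext ?_⟩
  apply mul_left_cancel₀ (pow_ne_zero s hp.ne_zero)
  rw [coe_mulLin, ← hT' f f.2, ← key f f.2, hq]
  ring

/-- The homomorphism `ι : ∇(r-s) → ∇(r) ⊗ Δ(s)`: the tensor corresponding to the multiplication by
a form of degree `r - s`. -/
def kernelHom (K : Type*) [Field K] {r s : ℕ} (hrs : s ≤ r) :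
    (nabla K (r - s)).IntertwiningMap ((nabla K r).tprod (weyl K s)) :=
  (homEquiv K r s).symm.toIntertwiningMap.comp (mulIntertwining K hrs)

theorem homEquiv_kernelHom (K : Type*) [Field K] {r s : ℕ} (hrs : s ≤ r) (q : SymPow K (r - s)) :
    homEquiv K r s (kernelHom K hrs q) = mulLin K hrs q :=
  (homEquiv K r s).apply_symm_apply _

theorem kernelHom_injective (K : Type*) [Field K] {r s : ℕ} (hrs : s ≤ r) :
    Function.Injective (kernelHom K hrs) := by
  intro q q' h
  have h1 : mulLin K hrs q = mulLin K hrs q' := by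
    rw [← homEquiv_kernelHom, h, homEquiv_kernelHom]
  have h2 := congrArg Subtype.val
    (LinearMap.congr_fun h1 ⟨_, ι_pow_mem_symPow (Pi.single 1 1 : E K) s⟩)
  exact Subtype.ext (mul_right_cancel₀ (pow_ne_zero s (prime_ι_single K 1).ne_zero) h2)

theorem exact_kernelHom_theta (K : Type*) [Field K] {r s : ℕ} (hs : 0 < s) (hrs : s ≤ r) :
    Function.Exact (kernelHom K hrs) (theta K r hs) := by
  intro t
  have h0 : theta K r hs t = 0 ↔ homEquiv K (r + 1) (s - 1) (theta K r hs t) = 0 :=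
    ((homEquiv K (r + 1) (s - 1)).toLinearEquiv.map_eq_zero_iff).symm
  rw [h0]
  constructor
  · intro h
    obtain ⟨q, hq⟩ := exists_mulLin_eq K hs hrs (homEquiv K r s t) fun f => by
      rw [← sub_eq_zero, ← homEquiv_theta K r hs, h, LinearMap.zero_apply]
    exact ⟨q, (homEquiv K r s).toLinearEquiv.injective ((homEquiv_kernelHom K hrs q).trans hq)⟩
  · rintro ⟨q, rfl⟩
    refine LinearMap.ext fun f => ?_
    rw [homEquiv_theta, homEquiv_kernelHom, LinearMap.zero_apply, sub_eq_zero]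
    ext
    simp only [coe_symMul, coe_mulLin]
    ring

/-! ### Injectivity of `β` and surjectivity of `θ` -/

theorem weylHom_injective (K : Type*) [Field K] {s : ℕ} (hs : 0 < s) :
    Function.Injective (weylHom K hs) := by
  refine (injective_iff_map_eq_zero (weylHom K hs)).2 fun φ hφ => ?_
  replace hφ : weylLin K hs φ = 0 := hφ
  have h (y : E K) (f : SymPow K (s - 1)) :
      φ (symMul K (Nat.sub_add_cancel hs).symm f y) = 0 := by
    rw [← weylLin_spec K hs, hφ]
    simp
  have hmul : SymPow K s = SymPow K (s - 1) * LinearMap.range (SymmetricAlgebra.ι K (E K)) := by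
    rw [SymPow, SymPow, ← pow_succ, Nat.sub_add_cancel hs]
  suffices H : ∀ f, f ∈ SymPow K (s - 1) * LinearMap.range (SymmetricAlgebra.ι K (E K)) →
      ∃ hf : f ∈ SymPow K s, φ ⟨f, hf⟩ = 0 from
    LinearMap.ext fun f => (H f (hmul ▸ f.2)).2
  intro f hf
  induction hf using Submodule.mul_induction_on' with
  | add f _ f' _ ih ih' =>
    obtain ⟨hf, h0⟩ := ih
    obtain ⟨hf', h0'⟩ := ih'
    exact ⟨add_mem hf hf', (map_add φ ⟨f, hf⟩ ⟨f', hf'⟩).trans (by rw [h0, h0', add_zero])⟩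
  | mem_mul_mem f hf z hz =>
    obtain ⟨y, rfl⟩ := hz
    exact ⟨_, h y ⟨f, hf⟩⟩

/-- The kernel of `θ` has dimension `r - s + 1 = (r + 1)(s + 1) - (r + 2)s`, so `θ` is surjective
by counting dimensions. -/
theorem theta_surjective (K : Type*) [Field K] {r s : ℕ} (hs : 0 < s) (hrs : s ≤ r) :
    Function.Surjective (theta K r hs) := by
  let θ : SymPow K r ⊗[K] Module.Dual K (SymPow K s) →ₗ[K]
    SymPow K (r + 1) ⊗[K] Module.Dual K (SymPow K (s - 1)) := (theta K r hs).toLinearMap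
  have hker : LinearMap.ker θ = LinearMap.range (kernelHom K hrs).toLinearMap :=
    LinearMap.exact_iff.1 (exact_kernelHom_theta K hs hrs)
  -- The spaces are named so that their additive group structures are found by inference.
  have hdim := LinearMap.finrank_range_add_finrank_ker (K := K)
    (V := SymPow K r ⊗[K] Module.Dual K (SymPow K s))
    (V₂ := SymPow K (r + 1) ⊗[K] Module.Dual K (SymPow K (s - 1))) θ
  rw [hker, LinearMap.finrank_range_of_inj (kernelHom_injective K hrs),
    Module.finrank_tensorProduct, Subspace.dual_finrank_eq] at hdim
  simp only [finrank_symPow] at hdim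
  have htop : LinearMap.range θ = ⊤ := by
    refine Submodule.eq_top_of_finrank_eq (K := K)
      (V := SymPow K (r + 1) ⊗[K] Module.Dual K (SymPow K (s - 1))) ?_
    rw [Module.finrank_tensorProduct, Subspace.dual_finrank_eq]
    simp only [finrank_symPow]
    obtain ⟨m, rfl⟩ := Nat.exists_eq_add_of_le hrs
    obtain ⟨k, rfl⟩ := Nat.exists_eq_add_of_le' hs
    simp only [Nat.add_sub_cancel_left, Nat.add_sub_cancel] at hdim ⊢
    nlinarith
  exact LinearMap.range_eq_top.1 htop

end

end SLTwo

theorem proposition2p1 (K : Type*) [Field K] [IsAlgClosed K] (r s : ℕ) (hs : 0 < s) (hrs : s ≤ r) :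
    Function.Injective (SLTwo.weylHom K hs) ∧
    ∃ ι : (SLTwo.nabla K (r - s)).IntertwiningMap
        ((SLTwo.nabla K r).tprod (SLTwo.weyl K s)),
      Function.Injective ι ∧
      Function.Exact ι (SLTwo.theta K r hs) ∧
      Function.Surjective (SLTwo.theta K r hs) :=
  ⟨SLTwo.weylHom_injective K hs, SLTwo.kernelHom K hrs, SLTwo.kernelHom_injective K hrs,
    SLTwo.exact_kernelHom_theta K hs hrs, SLTwo.theta_surjective K hs hrs⟩
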